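/- Let $G=\mathrm{Sym}(\mathbb N)$. For a set $X$ with an action of $G$, a set $D\subseteq\mathbb N$ supports $x\in X$ if every $\pi\in G$ fixing each element of $D$ satisfies $\pi\cdot x=x$; a finite $D$ is the least support of $x$ if it supports $x$, no proper subset of $D$ supports $x$, and no other finite set has these two properties. $X$ is a nominal set if each of its elements has a least support; its nominal dimension is the supremum of the sizes of these least supports, and $X$ is orbit-finite if it has finitely many $G$-orbits. Let $A$ be an orbit-finite nominal set (the $G$-alphabet), with $G$ acting letterwise on $A^*$. A $G$-language is a function $L:A^*\to\{0,1\}$ for which $\{w : L(w)=1\}$ is closed under the action of $G$. A nominal DFA over $A$ consists of an orbit-finite nominal set $Q$ of states, an equivariant transition function $\delta:Q\times A\to Q$, an initial state $q_0$ with $G\cdot q_0=\{q_0\}$, and an equivariant set $F\subseteq Q$ of accepting states; it recognizes languages as usual. Let $\mathcal L^{\mathrm{nom}}_A(n,k)$ be the set of $G$-languages over $A$ recognized by a nominal DFA whose state set has at most $n$ orbits and nominal dimension at most $k$. For sets $\mathcal C\subseteq\mathcal H$ of functions $X\to\{0,1\}$, the (EQ+MQ)-query complexity of $\mathcal C$ with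 queries from $\mathcal H$ is the least $m\in\mathbb N$ (or $\infty$ if there is none) such that some adaptive learner identifies every target $C\in\mathcal C$ within at most $m$ queries, i.e. one of its first $m$ queries is the equivalence query $C$, whatever correct answers the oracle gives. Here a query is either an equivalence query $H\in\mathcal H$, answered by "yes" if $H=C$ and otherwise by some $x$ with $H(x)\ne C(x)$, or a membership query $x\in X$, answered by $C(x)$. **Theorem.** Fix an orbit-finite $G$-alphabet $A$. For every $c\in\mathbb N$ there is a constant $K\in\mathbb N$, depending only on $A$ and $c$, such that for all integers $n\ge 2$ and $k$ with $1\le k\le n^c$, the (EQ+MQ)-query complexity of $\mathcal L^{\mathrm{nom}}_A(n,k)$ with queries from $\mathcal L^{\mathrm{nom}}_A(n,k)$ is at most $\dfrac{n^{Kk}}{k^k}$. -/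

import Mathlib

namespace NominalLearning

universe u

/-! ### Query learning -/

/-- A query over the instance space `X`: an equivalence query submits a hypothesis, a membership
query submits an instance. -/
inductive Query (X : Type u) : Type u
  | eq (H : X → Bool)
  | mem (x : X)

/-- The answers an oracle can give. -/
inductive Answer (X : Type u) : Type u
  | yes
  | counterexample (x : X)
  | value (b : Bool)

/-- `CorrectAnswer C q a`: the oracle with target concept `C` may answer the query `q` by `a`. -/
def CorrectAnswer {X : Type u} (C : X → Bool) : Query X → Answer X → Prop
  | .eq H, .yes => H = C
  | .eq H, .counterexample x => H x ≠ C x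
  | .mem x, .value b => C x = b
  | _, _ => False

/-- A (deterministic, adaptive) learner chooses the next query from the list of all earlier queries
and their answers (oldest first). -/
abbrev Learner (X : Type u) : Type u := List (Query X × Answer X) → Query X

/-- `IsTranscript A C h`: the list `h` of queries and answers can arise when the learner `A` plays
against an oracle with target concept `C`. -/
inductive IsTranscript {X : Type u} (A : Learner X) (C : X → Bool) :
    List (Query X × Answer X) → Prop
  | nil : IsTranscript A C []
  | snoc {h : List (Query X × Answer X)} {a : Answer X} (hh : IsTranscript A C h)
      (ha : CorrectAnswer C (A h) a) : IsTranscript A C (h ++ [(A h, a)])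

/-- Every equivalence query of the learner is taken from the hypothesis class `𝓗`; membership
queries are unrestricted. -/
def Learner.UsesHypotheses {X : Type u} (A : Learner X) (𝓗 : Set (X → Bool)) : Prop :=
  ∀ h H, A h = Query.eq H → H ∈ 𝓗

/-- The learner `A` identifies `C` within `m` queries: whatever correct answers the oracle gives,
one of the first `m` queries is the equivalence query submitting `C` itself. -/
def Learner.IdentifiesWithin {X : Type u} (A : Learner X) (C : X → Bool) (m : ℕ) : Prop :=
  ∀ h, IsTranscript A C h → h.length = m → ∃ e ∈ h, e.1 = Query.eq C

/-- The (EQ+MQ)-query complexity of the concept class `𝓒` with queries from `𝓗`: the least `m` such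
that some learner, submitting only hypotheses from `𝓗`, identifies every `C ∈ 𝓒` within `m`
queries; `⊤` if there is no such `m`. -/
noncomputable def queryComplexity {X : Type u} (𝓒 𝓗 : Set (X → Bool)) : ℕ∞ :=
  ⨅ (m : ℕ) (_ : ∃ A : Learner X, A.UsesHypotheses 𝓗 ∧ ∀ C ∈ 𝓒, A.IdentifiesWithin C m), (m : ℕ∞)

/-! ### Nominal sets for the equality symmetry -/

/-- The group `Sym(ℕ)`. -/
abbrev G : Type := Equiv.Perm ℕ

/-- The finite set `D` supports `x`, and no proper subset of `D` does. -/
def IsMinimalSupport {X : Type u} [MulAction G X] (D : Finset ℕ) (x : X) : Prop :=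
  MulAction.Supports G (D : Set ℕ) x ∧ ∀ E : Finset ℕ, E ⊂ D → ¬ MulAction.Supports G (E : Set ℕ) x

/-- `D` is the least support of `x`: it is the only finite minimal support of `x`. -/
def IsLeastSupport {X : Type u} [MulAction G X] (D : Finset ℕ) (x : X) : Prop :=
  IsMinimalSupport D x ∧ ∀ E : Finset ℕ, IsMinimalSupport E x → E = D

/-- A nominal set: every element has a least support. -/
def IsNominal (X : Type u) [MulAction G X] : Prop :=
  ∀ x : X, ∃ D : Finset ℕ, IsLeastSupport D x

/-- The number of orbits of `X`. -/
noncomputable def numOrbits (X : Type u) [MulAction G X] : ℕ∞ :=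
  ENat.card (MulAction.orbitRel.Quotient G X)

/-- `X` has only finitely many orbits. -/
def OrbitFinite (X : Type u) [MulAction G X] : Prop :=
  Finite (MulAction.orbitRel.Quotient G X)

/-- The nominal dimension of `X`: the supremum of the sizes of the least supports of its
elements. -/
noncomputable def nominalDim (X : Type u) [MulAction G X] : ℕ∞ :=
  ⨆ (x : X) (D : Finset ℕ) (_ : IsLeastSupport D x), (D.card : ℕ∞)

/-- A subset closed under the action. -/
def IsEquivariantSet {X : Type u} [MulAction G X] (Y : Set X) : Prop :=
  ∀ y ∈ Y, ∀ π : G, π • y ∈ Y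

/-! ### Languages and automata over a `G`-alphabet -/

/-- A `G`-language: the set of accepted words is closed under the letterwise action of `G`. -/
def IsGLanguage {A : Type u} [MulAction G A] (L : List A → Bool) : Prop :=
  ∀ w, L w = true → ∀ π : G, L (w.map (π • ·)) = true

/-- A nominal DFA over `A`. Orbit-finite nominal sets are countable, so taking the state set in the
universe of `A` is no restriction up to isomorphism. -/
structure NominalDFA (A : Type u) [MulAction G A] where
  /-- The states. -/
  Q : Type u
  /-- The action on the states. -/
  [action : MulAction G Q]
  nominal : IsNominal Q
  orbitFinite : OrbitFinite Q
  /-- The transition function, initial state and accepting states (`DFA` itself requires no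
  finiteness). -/
  toDFA : DFA A Q
  step_equivariant : ∀ (π : G) (q : Q) (a : A), toDFA.step (π • q) (π • a) = π • toDFA.step q a
  orbit_start : MulAction.orbit G toDFA.start = {toDFA.start}
  accept_equivariant : IsEquivariantSet toDFA.accept

attribute [instance] NominalDFA.action

/-- The automaton `M` recognizes `L`. -/
def NominalDFA.Recognizes {A : Type u} [MulAction G A] (M : NominalDFA A) (L : List A → Bool) :
    Prop :=
  ∀ w, w ∈ M.toDFA.accepts ↔ L w = true

/-- The class of `G`-languages over `A` recognized by a nominal DFA with at most `n` orbits and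
nominal dimension at most `k`. -/
def nominalLanguages (A : Type u) [MulAction G A] (n k : ℕ) : Set (List A → Bool) :=
  {L | IsGLanguage L ∧
    ∃ M : NominalDFA A, numOrbits M.Q ≤ n ∧ nominalDim M.Q ≤ k ∧ M.Recognizes L}

end NominalLearning

/-!
If every function that agrees with some concept of a finite class on each set of `m` instances is
an admissible hypothesis, the majority vote of the remaining concepts either is a legal equivalence
query or is refuted by `m` membership queries, so `O(m * log N)` queries suffice for `N` concepts.

A function that agrees on enough sets of words with automata having `n` orbits and dimension `k` is
a `G`-language whose minimal automaton is as small. If the minimal automaton had too many orbits,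
`n + 1` words of length at most `n` would reach distinct ones; if its dimension were too large, one
such word would reach a residual without a support of size `k`. Either failure shows on
`poly(n) ^ k` pairs of words with distinct residuals, one for each partial permutation of `k` of the
names that occur (respectively, for each set of `k` of them), whereas an automaton with `n` orbits
and dimension `k` sends both words of one of these pairs to the same state.

Finally, a small automaton is determined by its transitions between representatives of the orbits,
and the permutations involved matter only on `k` or `p` names and may be assumed to take values
below `k + p`, where `p` bounds the supports of the letters. This leaves
`2 ^ (poly(n, k) * (k + p) ^ k)` automata.
-/

namespace NominalLearning

universe u

open MulAction Finset
open scoped Pointwise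

/-! ### Halving with membership and equivalence queries -/

section Learning

variable {X : Type u} {𝓒 𝓗 V W : Set (X → Bool)} {m m' : ℕ}

/-- Some learner submitting only hypotheses from `𝓗` identifies every concept of `V` within `m`
queries. -/
def IsIdentifiable (𝓗 : Set (X → Bool)) (m : ℕ) (V : Set (X → Bool)) : Prop :=
  ∃ A : Learner X, A.UsesHypotheses 𝓗 ∧ ∀ C ∈ V, A.IdentifiesWithin C m

/-- The concepts of `V` that are still to be identified after the query `q` has been answered
by `a`. -/
def survivors (V : Set (X → Bool)) (q : Query X) (a : Answer X) : Set (X → Bool) :=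
  {C ∈ V | CorrectAnswer C q a ∧ q ≠ .eq C}

lemma IsTranscript.eq_nil_or_exists_cons {A : Learner X} {C : X → Bool}
    {h : List (Query X × Answer X)} (hh : IsTranscript A C h) :
    h = [] ∨ ∃ a t, h = (A [], a) :: t ∧ CorrectAnswer C (A []) a ∧
      IsTranscript (fun s => A ((A [], a) :: s)) C t := by
  induction hh with
  | nil => exact .inl rfl
  | @snoc h b _ hb ih =>
    right
    obtain rfl | ⟨a, t, rfl, ha, ht⟩ := ih
    · exact ⟨b, [], rfl, hb, .nil⟩
    · exact ⟨a, t ++ [(A ((A [], a) :: t), b)], rfl, ha, ht.snoc hb⟩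

namespace IsIdentifiable

lemma queryComplexity_le (h : IsIdentifiable 𝓗 m 𝓒) : queryComplexity 𝓒 𝓗 ≤ m :=
  iInf₂_le m h

lemma mono (h : IsIdentifiable 𝓗 m W) (hVW : V ⊆ W) : IsIdentifiable 𝓗 m V := by
  obtain ⟨A, hA, hAW⟩ := h
  exact ⟨A, hA, fun C hC => hAW C (hVW hC)⟩

lemma of_query (q : Query X) (hq : ∀ H, q = .eq H → H ∈ 𝓗)
    (h : ∀ a, IsIdentifiable 𝓗 m (survivors V q a)) : IsIdentifiable 𝓗 (m + 1) V := by
  choose A hA𝓗 hA using h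
  let B : Learner X
    | [] => q
    | (_, a) :: t => A a t
  refine ⟨B, fun h H hH => ?_, fun C hC h hh hlen => ?_⟩
  · cases h with
    | nil => exact hq H hH
    | cons e t => exact hA𝓗 e.2 t H hH
  · obtain rfl | ⟨a, t, rfl, ha, ht⟩ := hh.eq_nil_or_exists_cons
    · simp at hlen
    by_cases hqC : q = .eq C
    · exact ⟨_, List.mem_cons_self, hqC⟩
    · obtain ⟨e, he, heC⟩ := hA a C ⟨hC, ha, hqC⟩ t ht (by simpa using hlen)
      exact ⟨e, List.mem_cons_of_mem _ he, heC⟩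

variable [Nonempty X]

lemma empty : IsIdentifiable 𝓗 m ∅ :=
  ⟨fun _ => .mem (Classical.arbitrary X), by simp [Learner.UsesHypotheses], by simp⟩

lemma of_le (hm : m ≤ m') (h : IsIdentifiable 𝓗 m V) : IsIdentifiable 𝓗 m' V := by
  induction hm with
  | refl => exact h
  | step _ ih =>
    exact of_query (.mem (Classical.arbitrary X)) (by simp) fun _ => ih.mono fun _ hC => hC.1

lemma of_eq_query {H : X → Bool} (hH : H ∈ 𝓗) (h : ∀ x, IsIdentifiable 𝓗 m {C ∈ V | C x ≠ H x}) :
    IsIdentifiable 𝓗 (m + 1) V := by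
  refine of_query (.eq H) (by rintro _ ⟨⟩; exact hH) fun a => ?_
  cases a with
  | yes => exact empty.mono fun C hC => hC.2.2 (congrArg _ hC.2.1)
  | counterexample x => exact (h x).mono fun C hC => ⟨hC.1, Ne.symm hC.2.1⟩
  | value b => exact empty.mono fun C hC => hC.2.1

lemma of_mem_query {x : X} (h : ∀ b, IsIdentifiable 𝓗 m {C ∈ V | C x = b}) :
    IsIdentifiable 𝓗 (m + 1) V := by
  refine of_query (.mem x) (by simp) fun a => ?_
  cases a with
  | yes => exact empty.mono fun C hC => hC.2.1
  | counterexample y => exact empty.mono fun C hC => hC.2.1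
  | value b => exact (h b).mono fun C hC => ⟨hC.1, hC.2.1⟩

lemma of_refuting_list {f : X → Bool} (Z : List X)
    (hdis : ∀ x ∈ Z, IsIdentifiable 𝓗 m {C ∈ V | C x ≠ f x})
    (href : ∀ C ∈ V, ∃ x ∈ Z, C x ≠ f x) : IsIdentifiable 𝓗 (Z.length + m) V := by
  induction Z generalizing V with
  | nil => exact empty.mono fun C hC => by simpa using href C hC
  | cons x Z ih =>
    rw [List.length_cons, Nat.add_right_comm]
    refine of_mem_query (x := x) fun b => ?_
    by_cases hb : b = f x
    · refine ih (fun y hy => ?_) fun C hC => ?_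
      · exact (hdis y (List.mem_cons_of_mem _ hy)).mono fun C hC => ⟨hC.1.1, hC.2⟩
      · obtain ⟨y, hy, hne⟩ := href C hC.1
        obtain rfl | hy := List.mem_cons.1 hy
        · exact absurd (hC.2.trans hb) hne
        · exact ⟨y, hy, hne⟩
    · refine ((hdis x List.mem_cons_self).mono ?_).of_le (Nat.le_add_left m Z.length)
      rintro C ⟨hC, rfl⟩
      exact ⟨hC, hb⟩

end IsIdentifiable

lemma exists_two_mul_ncard_ne_le (hV : V.Finite) :
    ∃ f : X → Bool, ∀ x, 2 * {C ∈ V | C x ≠ f x}.ncard ≤ V.ncard := by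
  suffices ∀ x, ∃ b, 2 * {C ∈ V | C x ≠ b}.ncard ≤ V.ncard by
    choose f hf using this
    exact ⟨f, hf⟩
  intro x
  have hsum := Set.ncard_inter_add_ncard_sdiff_eq_ncard V {C | C x ≠ true} hV
  have hsdiff : V \ {C | C x ≠ true} = {C ∈ V | C x ≠ false} := by ext; simp
  rw [hsdiff, Set.inter_ofPred_eq_sep] at hsum
  by_cases htrue : 2 * {C ∈ V | C x ≠ true}.ncard ≤ V.ncard
  · exact ⟨true, htrue⟩
  · exact ⟨false, by omega⟩

/-- The function `f` is `m`-consistent with the class `𝓒`: on every set of at most `m` instances it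
agrees with some concept of `𝓒`. The consistency dimension of `𝓒` with respect to `𝓗` is the least
`m` such that every `m`-consistent function belongs to `𝓗`. -/
def IsConsistent (𝓒 : Set (X → Bool)) (m : ℕ) (f : X → Bool) : Prop :=
  ∀ Z : Finset X, #Z ≤ m → ∃ C ∈ 𝓒, ∀ x ∈ Z, C x = f x

/-- Each round halves the version space: its majority vote `f` is either submitted as an equivalence
query or, if `f ∉ 𝓗`, compared with the target on `m` instances where `f` is not consistent
with `𝓒`. -/
lemma isIdentifiable_of_ncard_lt_two_pow [Nonempty X] (hm : 1 ≤ m)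
    (hcons : ∀ f, IsConsistent 𝓒 m f → f ∈ 𝓗) {d : ℕ} (hV : V.Finite) (hV𝓒 : V ⊆ 𝓒)
    (hd : V.ncard < 2 ^ d) : IsIdentifiable 𝓗 (m * d) V := by
  induction d generalizing V with
  | zero =>
    obtain rfl : V = ∅ := (Set.ncard_eq_zero hV).1 (by simpa using hd)
    exact .empty
  | succ d ih =>
    obtain ⟨f, hf⟩ := exists_two_mul_ncard_ne_le hV
    have hhalf (x : X) : IsIdentifiable 𝓗 (m * d) {C ∈ V | C x ≠ f x} := by
      refine ih (hV.subset (Set.sep_subset _ _)) ((Set.sep_subset _ _).trans hV𝓒) ?_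
      have := hf x
      rw [pow_succ] at hd
      omega
    rw [Nat.mul_succ]
    by_cases hf𝓗 : f ∈ 𝓗
    · exact (IsIdentifiable.of_eq_query hf𝓗 hhalf).of_le (by omega)
    · obtain ⟨Z, hZ, href⟩ : ∃ Z : Finset X, #Z ≤ m ∧ ∀ C ∈ 𝓒, ∃ x ∈ Z, C x ≠ f x := by
        simpa [IsConsistent] using mt (hcons f) hf𝓗
      have := IsIdentifiable.of_refuting_list Z.toList (fun x _ => hhalf x)
        fun C hC => by simpa using href C (hV𝓒 hC)
      exact this.of_le (by rw [Finset.length_toList]; omega)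

theorem queryComplexity_le_mul_of_isConsistent [Nonempty X] (h𝓒 : 𝓒.Finite) (hm : 1 ≤ m) {d : ℕ}
    (hd : 𝓒.ncard < 2 ^ d) (hcons : ∀ f, IsConsistent 𝓒 m f → f ∈ 𝓗) :
    queryComplexity 𝓒 𝓗 ≤ (m * d : ℕ) :=
  (isIdentifiable_of_ncard_lt_two_pow hm hcons h𝓒 subset_rfl hd).queryComplexity_le

end Learning

/-! ### Supports -/

section Supports

section Group

variable {Γ α X : Type*} [Group Γ] [MulAction Γ α] [MulAction Γ X] {s : Set α} {x : X}

lemma smul_eq_smul_of_supports (h : Supports Γ s x) {g g' : Γ} (hg : ∀ a ∈ s, g • a = g' • a) :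
    g • x = g' • x := by
  rw [← inv_smul_eq_iff, smul_smul]
  exact h _ fun a ha => by rw [mul_smul, hg a ha, inv_smul_smul]

lemma supports_smul (g : Γ) (h : Supports Γ s x) : Supports Γ (g • s) (g • x) := fun g' hg' => by
  rw [smul_smul]
  exact smul_eq_smul_of_supports h fun a ha => by
    rw [mul_smul, hg' (Set.smul_mem_smul_set ha)]

end Group

section Perm

variable {α X : Type*} {D E K Y : Finset α}

lemma exists_perm_fixing_eqOn {g : α → α} (hKE : Disjoint K E) (hg : Set.InjOn g E)
    (hgK : ∀ a ∈ E, g a ∉ K) :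
    ∃ π : Equiv.Perm α, (∀ a ∈ K, π a = a) ∧ ∀ a ∈ E, π a = g a := by
  classical
  have hinj : Set.InjOn (fun a => if a ∈ K then a else g a) (K ∪ E : Finset α) := by
    have hE : ∀ a ∈ E, a ∉ K := fun a ha haK => Finset.disjoint_left.1 hKE haK ha
    rw [Finset.coe_union, Set.injOn_union (Finset.disjoint_coe.2 hKE)]
    refine ⟨fun a ha b hb => ?_, fun a ha b hb => ?_, fun a ha b hb hab => hgK b hb ?_⟩
    · simp_all
    · simpa [hE a ha, hE b hb] using hg ha hb
    · simp_all
  obtain ⟨π, hπ⟩ := Equiv.Perm.exists_extending_pair ((↑) : (K ∪ E : Finset α) → α) _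
    Subtype.val_injective (Set.injOn_iff_injective.1 hinj)
  refine ⟨π, fun a ha => ?_, fun a ha => ?_⟩
  · simpa [ha] using hπ ⟨a, mem_union_left _ ha⟩
  · simpa [Finset.disjoint_right.1 hKE ha] using hπ ⟨a, mem_union_right _ ha⟩

variable [DecidableEq α]

lemma exists_perm_fixing_mapsTo (hYK : Disjoint Y K) (hE : #(E \ K) ≤ #Y) :
    ∃ π : Equiv.Perm α, (∀ a ∈ K, π a = a) ∧ ∀ a ∈ E, a ∉ K → π a ∈ Y := by
  obtain hE' | hne := (E \ K).eq_empty_or_nonempty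
  · exact ⟨1, by simp, fun a ha haK =>
      (notMem_empty a (hE' ▸ mem_sdiff.2 ⟨ha, haK⟩)).elim⟩
  have : Nonempty α := ⟨hne.choose⟩
  obtain ⟨g, hg, hginj⟩ := (E \ K).finite_toSet.exists_injOn_of_encard_le (t := (Y : Set α))
    (by simpa only [Set.encard_coe_eq_coe_finsetCard, Nat.cast_le] using hE)
  obtain ⟨π, hπK, hπg⟩ := exists_perm_fixing_eqOn disjoint_sdiff hginj
    fun a ha => Finset.disjoint_left.1 hYK (hg ha)
  refine ⟨π, hπK, fun a ha haK => ?_⟩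
  have ha' : a ∈ E \ K := mem_sdiff.2 ⟨ha, haK⟩
  exact hπg a ha' ▸ hg ha'

variable [Infinite α] [MulAction (Equiv.Perm α) X] {x : X}

/-- A permutation that fixes `D` fixes `x`, and can move the names in `E \ D` to fresh ones. -/
lemma exists_supports_disjoint_sdiff (hD : Supports (Equiv.Perm α) (D : Set α) x)
    (hE : Supports (Equiv.Perm α) (E : Set α) x) (B : Finset α) :
    ∃ F : Finset α, Supports (Equiv.Perm α) (F : Set α) x ∧ F ∩ D ⊆ E ∧ Disjoint (F \ D) B := by
  obtain ⟨Y, hY, hYcard⟩ :=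
    (D ∪ B).finite_toSet.infinite_compl.exists_subset_card_eq #(E \ D)
  have hYfresh : ∀ y ∈ Y, y ∉ D ∧ y ∉ B := fun y hy => by simpa using hY hy
  obtain ⟨ρ, hρD, hρE⟩ := exists_perm_fixing_mapsTo
    (Finset.disjoint_left.2 fun y hy => (hYfresh y hy).1) hYcard.ge
  refine ⟨ρ • E, ?_, fun b hb => ?_, Finset.disjoint_left.2 fun b hb => ?_⟩
  · simpa [hD ρ fun a ha => hρD a ha] using supports_smul ρ hE
  · obtain ⟨hbE, hbD⟩ := mem_inter.1 hb
    obtain ⟨a, ha, rfl⟩ := mem_smul_finset.1 hbE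
    rw [Equiv.Perm.smul_def] at hbD ⊢
    rwa [ρ.injective (hρD _ hbD)]
  · obtain ⟨hbE, hbD⟩ := mem_sdiff.1 hb
    obtain ⟨a, ha, rfl⟩ := mem_smul_finset.1 hbE
    refine (hYfresh _ (hρE a ha fun haD => hbD ?_)).2
    rwa [Equiv.Perm.smul_def, hρD a haD]

lemma supports_inter (hD : Supports (Equiv.Perm α) (D : Set α) x)
    (hE : Supports (Equiv.Perm α) (E : Set α) x) :
    Supports (Equiv.Perm α) ((D ∩ E : Finset α) : Set α) x := fun π hπ => by
  have hπDE : ∀ a ∈ D, a ∈ E → π a = a := fun a haD haE => hπ (by simp [haD, haE])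
  obtain ⟨F, hF, hFD, hFfresh⟩ := exists_supports_disjoint_sdiff hD hE (π⁻¹ • D)
  obtain ⟨τ, hτD, hτF⟩ := exists_perm_fixing_eqOn (g := π) (disjoint_sdiff : Disjoint D (F \ D))
    π.injective.injOn fun a ha haD => Finset.disjoint_left.1 hFfresh ha
      (mem_inv_smul_finset_iff.2 haD)
  have hπτ : π • x = τ • x := smul_eq_smul_of_supports hF fun a ha => by
    by_cases haD : a ∈ D
    · exact (hπDE a haD (hFD (mem_inter.2 ⟨ha, haD⟩))).trans (hτD a haD).symm
    · exact (hτF a (mem_sdiff.2 ⟨ha, haD⟩)).symm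
  rw [hπτ]
  exact hD τ fun a ha => hτD a ha

end Perm

variable {X : Type*} [MulAction G X] {D E : Finset ℕ} {x : X}

lemma IsMinimalSupport.subset (h : IsMinimalSupport D x) (hE : Supports G (E : Set ℕ) x) :
    D ⊆ E := by
  by_contra hDE
  exact h.2 (D ∩ E) (inter_subset_left.ssubset_of_ne (mt inter_eq_left.1 hDE))
    (supports_inter h.1 hE)

lemma IsLeastSupport.supports (h : IsLeastSupport D x) : Supports G (D : Set ℕ) x := h.1.1

lemma exists_isLeastSupport (h : Supports G (D : Set ℕ) x) : ∃ E, IsLeastSupport E x := by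
  obtain ⟨E, -, hE⟩ := exists_minimal_le_of_wellFoundedLT
    (fun E : Finset ℕ => Supports G (E : Set ℕ) x) D h
  have hmin : IsMinimalSupport E x := ⟨hE.prop, fun F hFE hF => hE.not_lt hF hFE⟩
  exact ⟨E, hmin, fun F hF => (hF.subset hmin.1).antisymm (hmin.subset hF.1)⟩

lemma IsLeastSupport.smul_subset {π : G} (h : IsLeastSupport D x)
    (hE : Supports G (E : Set ℕ) (π • x)) : π • D ⊆ E := by
  have hE' := supports_smul π⁻¹ hE
  rw [inv_smul_smul, ← coe_smul_finset] at hE'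
  exact smul_finset_subset_iff.2 (h.1.subset hE')

lemma nominalDim_le_iff {k : ℕ} :
    nominalDim X ≤ k ↔ ∀ (x : X) (D : Finset ℕ), IsLeastSupport D x → #D ≤ k := by
  simp only [nominalDim, iSup_le_iff, Nat.cast_le]

end Supports

/-! ### Representatives of the orbits -/

section Representatives

variable {O X : Type*} [MulAction G X] {n k p : ℕ}

/-- The family `r` meets every orbit of `X` in an element supported by `{0, …, p - 1}`. An orbit may
be met several times. -/
structure IsRepresentatives (p : ℕ) (r : O → X) : Prop where
  supports (o : O) : Supports G (range p : Set ℕ) (r o)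
  exists_smul_eq (x : X) : ∃ o, ∃ π : G, π • r o = x

lemma IsRepresentatives.comp {O' : Type*} {r : O → X} (hr : IsRepresentatives p r) {g : O' → O}
    (hg : g.Surjective) : IsRepresentatives p (r ∘ g) where
  supports o := hr.supports (g o)
  exists_smul_eq x := by
    obtain ⟨o, hx⟩ := hr.exists_smul_eq x
    obtain ⟨o', rfl⟩ := hg o
    exact ⟨o', hx⟩

lemma IsRepresentatives.exists_supports_card_le {r : O → X} (hr : IsRepresentatives p r) (x : X) :
    ∃ D : Finset ℕ, #D ≤ p ∧ Supports G (D : Set ℕ) x := by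
  obtain ⟨o, π, rfl⟩ := hr.exists_smul_eq x
  refine ⟨π • range p, by rw [card_smul_finset, card_range], ?_⟩
  rw [coe_smul_finset]
  exact supports_smul π (hr.supports o)

lemma exists_isRepresentatives_of_card_le
    (h : ∀ o : orbitRel.Quotient G X, ∃ D : Finset ℕ, #D ≤ p ∧ Supports G (D : Set ℕ) o.out) :
    ∃ r : orbitRel.Quotient G X → X, IsRepresentatives p r := by
  have hmove (o : orbitRel.Quotient G X) : ∃ π : G, Supports G (range p : Set ℕ) (π • o.out) := by
    obtain ⟨D, hDp, hD⟩ := h o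
    obtain ⟨π, -, hπ⟩ := exists_perm_fixing_mapsTo (disjoint_empty_right (range p)) (E := D)
      (by simpa using hDp)
    refine ⟨π, (supports_smul π hD).mono ?_⟩
    rintro _ ⟨a, ha, rfl⟩
    exact hπ a ha (notMem_empty a)
  choose π hπ using hmove
  refine ⟨fun o => π o • o.out, hπ, fun x => ?_⟩
  let o : orbitRel.Quotient G X := Quotient.mk _ x
  obtain ⟨g, hg⟩ : x ∈ orbit G o.out :=
    orbitRel_apply.1 ((orbitRel G X).symm (Quotient.mk_out x))
  exact ⟨o, g * (π o)⁻¹, by simpa [mul_smul] using hg⟩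

lemma exists_isRepresentatives (hX : IsNominal X) (hfin : OrbitFinite X) :
    ∃ (p : ℕ) (r : orbitRel.Quotient G X → X), IsRepresentatives p r := by
  have : Finite (orbitRel.Quotient G X) := hfin
  choose D hD using hX
  obtain ⟨p, hp⟩ := Finite.exists_le fun o : orbitRel.Quotient G X => #(D o.out)
  exact ⟨p, exists_isRepresentatives_of_card_le fun o => ⟨D o.out, hp o, (hD o.out).supports⟩⟩

lemma exists_surjective_fin_of_encard_le {α : Type*} [Nonempty α] (h : ENat.card α ≤ n) :
    ∃ g : Fin n → α, g.Surjective := by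
  have : Finite α := ENat.card_lt_top.1 (h.trans_lt (ENat.natCast_lt_top n))
  rw [ENat.card_eq_coe_natCard, Nat.cast_le] at h
  have := Fintype.ofFinite α
  obtain ⟨e⟩ := Function.Embedding.nonempty_of_card_le (α := α) (β := Fin n)
    (by simpa [Nat.card_eq_fintype_card] using h)
  exact ⟨_, Function.invFun_surjective e.injective⟩

lemma exists_isRepresentatives_fin [Nonempty X] (hX : IsNominal X) (hn : numOrbits X ≤ n)
    (hk : nominalDim X ≤ k) : ∃ q : Fin n → X, IsRepresentatives k q := by
  obtain ⟨r, hr⟩ := exists_isRepresentatives_of_card_le (X := X) fun o =>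
    (hX o.out).imp fun D hD => ⟨nominalDim_le_iff.1 hk o.out D hD, hD.supports⟩
  have : Nonempty (orbitRel.Quotient G X) := ‹Nonempty X›.map (Quotient.mk _)
  obtain ⟨g, hg⟩ := exists_surjective_fin_of_encard_le hn
  exact ⟨r ∘ g, hr.comp hg⟩

end Representatives

/-! ### Words, languages and runs -/

section Words

section Monoid

variable {Γ α A : Type*} [Monoid Γ] [MulAction Γ α] [MulAction Γ A]

/-- The letterwise action on words. -/
scoped instance : MulAction Γ (List A) where
  smul g w := w.map (g • ·)
  one_smul w := (List.map_congr_left fun a _ => one_smul Γ a).trans w.map_id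
  mul_smul g g' _ :=
    (List.map_congr_left fun a _ => mul_smul g g' a).trans List.map_map.symm

@[simp]
lemma smul_nil (g : Γ) : g • ([] : List A) = [] := rfl

@[simp]
lemma smul_cons (g : Γ) (a : A) (w : List A) : g • (a :: w) = g • a :: g • w := rfl

@[simp]
lemma smul_append (g : Γ) (v w : List A) : g • (v ++ w) = g • v ++ g • w := List.map_append

lemma supports_cons {s t : Set α} {a : A} {w : List A} (ha : Supports Γ s a)
    (hw : Supports Γ t w) : Supports Γ (s ∪ t) (a :: w) := fun g hg => by
  rw [smul_cons, ha g fun b hb => hg (.inl hb), hw g fun b hb => hg (.inr hb)]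

end Monoid

variable {A : Type*} [MulAction G A] {p : ℕ}

lemma exists_supports_word (h : ∀ a : A, ∃ D : Finset ℕ, #D ≤ p ∧ Supports G (D : Set ℕ) a)
    (w : List A) : ∃ D : Finset ℕ, #D ≤ w.length * p ∧ Supports G (D : Set ℕ) w := by
  induction w with
  | nil => exact ⟨∅, by simp, fun _ _ => rfl⟩
  | cons a w ih =>
    obtain ⟨D, hDp, hD⟩ := h a
    obtain ⟨E, hEp, hE⟩ := ih
    refine ⟨D ∪ E, (card_union_le D E).trans ?_, ?_⟩
    · rw [List.length_cons, Nat.succ_mul]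
      omega
    · rw [coe_union]
      exact supports_cons hD hE

lemma IsGLanguage.smul_eq {f : List A → Bool} (hf : IsGLanguage f) (π : G) (w : List A) :
    f (π • w) = f w := by
  have hmap : ∀ (π : G) (w : List A), f w = true → f (π • w) = true := fun π w h => hf w h π
  exact Bool.eq_iff_iff.2 ⟨fun h => by simpa using hmap π⁻¹ _ h, hmap π w⟩

end Words

namespace NominalDFA

variable {A : Type u} [MulAction G A] {M : NominalDFA A}

lemma smul_start (π : G) : π • M.toDFA.start = M.toDFA.start := by
  have h := mem_orbit M.toDFA.start π
  rwa [M.orbit_start] at h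

lemma smul_evalFrom (π : G) (x : M.Q) (w : List A) :
    π • M.toDFA.evalFrom x w = M.toDFA.evalFrom (π • x) (π • w) := by
  induction w generalizing x with
  | nil => rfl
  | cons a w ih =>
    rw [smul_cons, DFA.evalFrom_cons, DFA.evalFrom_cons, ih, M.step_equivariant]

lemma smul_eval (π : G) (w : List A) : π • M.toDFA.eval w = M.toDFA.eval (π • w) := by
  simp only [DFA.eval, smul_evalFrom, smul_start]

lemma supports_eval {s : Set ℕ} {w : List A} (h : Supports G s w) :
    Supports G s (M.toDFA.eval w) := fun π hπ => by
  rw [smul_eval, h π hπ]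

lemma supports_step {s t : Set ℕ} {x : M.Q} {a : A} (hx : Supports G s x) (ha : Supports G t a) :
    Supports G (s ∪ t) (M.toDFA.step x a) := fun π hπ => by
  rw [← M.step_equivariant, hx π fun b hb => hπ (.inl hb), ha π fun b hb => hπ (.inr hb)]

lemma smul_mem_accept_iff (π : G) (x : M.Q) : π • x ∈ M.toDFA.accept ↔ x ∈ M.toDFA.accept :=
  ⟨fun h => by simpa using M.accept_equivariant _ h π⁻¹, fun h => M.accept_equivariant x h π⟩

lemma Recognizes.append_eq {f : List A → Bool} (h : M.Recognizes f) {v w : List A}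
    (hvw : M.toDFA.eval v = M.toDFA.eval w) (e : List A) : f (v ++ e) = f (w ++ e) := by
  have heval : M.toDFA.eval (v ++ e) = M.toDFA.eval (w ++ e) := by
    simp only [DFA.eval, DFA.evalFrom_of_append] at hvw ⊢
    rw [hvw]
  rw [Bool.eq_iff_iff, ← h, ← h, DFA.mem_accepts, DFA.mem_accepts, heval]

end NominalDFA

/-! ### The minimal automaton -/

lemma exists_finset_injOn_of_lt_encard_image {α β : Type*} {φ : α → β} {s : Set α} {n : ℕ}
    (h : n < (φ '' s).encard) :
    ∃ S : Finset α, #S = n + 1 ∧ (S : Set α) ⊆ s ∧ Set.InjOn φ S := by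
  obtain ⟨t, hts, ht⟩ := Set.exists_subset_bijOn s φ
  rw [← ht.image_eq, ht.injOn.encard_image] at h
  obtain ⟨S, hSt, hS⟩ := Set.exists_subset_encard_eq (Order.add_one_le_of_lt h)
  obtain ⟨S, rfl⟩ := (Set.finite_of_encard_eq_coe (k := n + 1) hS).exists_finset_coe
  rw [Set.encard_coe_eq_coe_finsetCard] at hS
  exact ⟨S, by exact_mod_cast hS, hSt.trans hts, ht.injOn.mono hSt⟩

/-- The sets `φ '' {w | w.length ≤ n}` increase strictly with `n` until they are stationary. -/
lemma image_length_le_eq_range_or_lt_encard {A Ω : Type*} {φ : List A → Ω}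
    (hφ : ∀ v w a, φ v = φ w → ∃ b, φ (v ++ [a]) = φ (w ++ [b])) (n : ℕ) :
    φ '' {w | w.length ≤ n} = Set.range φ ∨ n < (φ '' {w | w.length ≤ n}).encard := by
  induction n with
  | zero => simp
  | succ n ih =>
    have hmono : φ '' {w | w.length ≤ n} ⊆ φ '' {w | w.length ≤ n + 1} :=
      Set.image_mono fun w hw => Nat.le_succ_of_le hw
    obtain hrange | hlt := ih
    · exact .inl ((Set.image_subset_range _ _).antisymm (hrange ▸ hmono))
    by_cases hstat : φ '' {w | w.length ≤ n + 1} ⊆ φ '' {w | w.length ≤ n}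
    · refine .inl ((Set.image_subset_range _ _).antisymm ?_)
      rintro _ ⟨w, rfl⟩
      induction w using List.reverseRecOn with
      | nil => exact ⟨[], by simp⟩
      | append_singleton w a ihw =>
        obtain ⟨v, hv, hvw⟩ := hstat ihw
        obtain ⟨b, hb⟩ := hφ w v a hvw.symm
        exact ⟨v ++ [b], by simpa using hv, hb.symm⟩
    · right
      obtain hfin | hinf := (φ '' {w | w.length ≤ n}).finite_or_infinite
      · push_cast
        exact (Order.add_one_le_of_lt hlt).trans_lt
          (hfin.encard_lt_encard ⟨hmono, hstat⟩)
      · rw [(hinf.mono hmono).encard_eq]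
        exact ENat.natCast_lt_top _

section Residuals

variable {A : Type u} {f : List A → Bool}

/-- The language with characteristic function `f`. -/
def languageOf (f : List A → Bool) : Language A := {w | f w = true}

variable [MulAction G A] {n k : ℕ}

/-- The pointwise action on languages. -/
scoped instance : MulAction G (Language A) := inferInstanceAs (MulAction G (Set (List A)))

lemma mem_smul_language_iff {π : G} {L : Language A} {w : List A} :
    w ∈ π • L ↔ π⁻¹ • w ∈ L :=
  Set.mem_smul_set_iff_inv_smul_mem

lemma smul_leftQuotient (hf : IsGLanguage f) (π : G) (w : List A) :
    π • (languageOf f).leftQuotient w = (languageOf f).leftQuotient (π • w) := by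
  ext e
  rw [mem_smul_language_iff, Language.mem_leftQuotient, Language.mem_leftQuotient]
  change f (w ++ π⁻¹ • e) = true ↔ f (π • w ++ e) = true
  rw [← hf.smul_eq π, smul_append, smul_inv_smul]

/-- The residuals of a `G`-language, i.e. the states of its minimal automaton. -/
def residuals (hf : IsGLanguage f) : SubMulAction G (Language A) where
  carrier := Set.range (languageOf f).leftQuotient
  smul_mem' := by
    rintro π _ ⟨w, rfl⟩
    exact ⟨π • w, (smul_leftQuotient hf π w).symm⟩

/-- The residual of a `G`-language after reading `w`. -/
def residual (hf : IsGLanguage f) (w : List A) : residuals hf :=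
  ⟨(languageOf f).leftQuotient w, w, rfl⟩

variable (hf : IsGLanguage f)

lemma residual_surjective : Function.Surjective (residual hf) := by
  rintro ⟨_, w, rfl⟩
  exact ⟨w, rfl⟩

variable {hf}

lemma residual_eq_residual_iff {v w : List A} :
    residual hf v = residual hf w ↔ ∀ e, f (v ++ e) = f (w ++ e) :=
  Subtype.ext_iff.trans <| Set.ext_iff.trans <| forall_congr' fun _ => Bool.eq_iff_iff.symm

lemma residual_append_congr {v w : List A} (h : residual hf v = residual hf w) (e : List A) :
    residual hf (v ++ e) = residual hf (w ++ e) := by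
  simp only [residual_eq_residual_iff, List.append_assoc] at h ⊢
  exact fun e' => h _

lemma smul_residual (π : G) (w : List A) : π • residual hf w = residual hf (π • w) :=
  Subtype.ext (smul_leftQuotient hf π w)

lemma supports_residual {s : Set ℕ} {w : List A} (h : Supports G s w) :
    Supports G s (residual hf w) := fun π hπ => by
  rw [smul_residual, h π hπ]

lemma mem_nominalLanguages_of_residuals
    (hsupp : ∀ w : List A, ∃ D : Finset ℕ, Supports G (D : Set ℕ) w)
    (hn : numOrbits (residuals hf) ≤ n) (hk : nominalDim (residuals hf) ≤ k) :
    f ∈ nominalLanguages A n k := by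
  let M : NominalDFA A :=
    { Q := residuals hf
      nominal x := by
        obtain ⟨w, rfl⟩ := residual_surjective hf x
        obtain ⟨D, hD⟩ := hsupp w
        exact exists_isLeastSupport (supports_residual hD)
      orbitFinite := ENat.card_lt_top.1 (hn.trans_lt (ENat.natCast_lt_top n))
      toDFA := (languageOf f).toDFA
      step_equivariant π x a := by
        have hstep (w : List A) (b : A) :
            (languageOf f).toDFA.step (residual hf w) b = residual hf (w ++ [b]) :=
          Subtype.ext ((languageOf f).leftQuotient_append w [b]).symm
        obtain ⟨w, rfl⟩ := residual_surjective hf x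
        rw [smul_residual, hstep, hstep, smul_residual, smul_append, smul_cons, smul_nil]
      orbit_start := by
        have hstart (π : G) : π • residual hf [] = residual hf [] := by
          rw [smul_residual, smul_nil]
        refine Set.eq_singleton_iff_unique_mem.2 ⟨mem_orbit_self _, ?_⟩
        rintro _ ⟨π, rfl⟩
        exact hstart π
      accept_equivariant x hx π := mem_smul_language_iff.2 hx }
  refine ⟨hf, M, hn, hk, fun w => ?_⟩
  change w ∈ (languageOf f).toDFA.accepts ↔ _
  rw [Language.accepts_toDFA]
  rfl

variable (hf) in
/-- The orbit of the residual after reading `w`. -/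
def residualOrbit (w : List A) : orbitRel.Quotient G (residuals hf) :=
  Quotient.mk _ (residual hf w)

variable (hf) in
lemma residualOrbit_surjective : Function.Surjective (residualOrbit hf) :=
  Quotient.mk_surjective.comp (residual_surjective hf)

lemma residualOrbit_eq_residualOrbit_iff {v w : List A} :
    residualOrbit hf v = residualOrbit hf w ↔ ∃ π : G, residual hf (π • w) = residual hf v :=
  Quotient.eq.trans <| exists_congr fun π => by
    rw [← smul_residual]

lemma exists_residualOrbit_append_eq {v w : List A} (a : A)
    (h : residualOrbit hf v = residualOrbit hf w) :
    ∃ b, residualOrbit hf (v ++ [a]) = residualOrbit hf (w ++ [b]) := by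
  obtain ⟨π, hπ⟩ := residualOrbit_eq_residualOrbit_iff.1 h
  refine ⟨π⁻¹ • a, residualOrbit_eq_residualOrbit_iff.2 ⟨π, ?_⟩⟩
  rw [smul_append, smul_cons, smul_inv_smul, smul_nil]
  exact residual_append_congr hπ [a]

lemma exists_short_words_of_lt_numOrbits (hn : n < numOrbits (residuals hf)) :
    ∃ S : Finset (List A), #S = n + 1 ∧ (∀ w ∈ S, w.length ≤ n) ∧
      Set.InjOn (residualOrbit hf) S := by
  refine exists_finset_injOn_of_lt_encard_image (s := {w : List A | w.length ≤ n}) ?_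
  obtain hrange | hlt := image_length_le_eq_range_or_lt_encard (φ := residualOrbit hf)
    (fun _ _ a => exists_residualOrbit_append_eq a) n
  · rwa [hrange, (residualOrbit_surjective hf).range_eq, Set.encard_univ]
  · exact hlt

lemma exists_short_word_of_numOrbits_le (hn : numOrbits (residuals hf) ≤ n) (x : residuals hf) :
    ∃ w : List A, w.length ≤ n ∧ ∃ π : G, residual hf (π • w) = x := by
  obtain ⟨v, rfl⟩ := residual_surjective hf x
  have hrange := (image_length_le_eq_range_or_lt_encard (φ := residualOrbit hf)
    (fun _ _ a => exists_residualOrbit_append_eq a) n).resolve_right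
    (not_lt.2 (Set.encard_le_card.trans hn))
  obtain ⟨w, hw, hwv⟩ := hrange.symm.subset (Set.mem_range_self v)
  exact ⟨w, hw, residualOrbit_eq_residualOrbit_iff.1 hwv.symm⟩

end Residuals

/-! ### Consistent functions belong to the class -/

lemma card_filter_powerset_card_le {α : Type*} (T : Finset α) (k : ℕ) :
    #{R ∈ T.powerset | #R ≤ k} ≤ (#T + 1) ^ k := by
  classical
  calc #{R ∈ T.powerset | #R ≤ k} ≤ #((range (k + 1)).biUnion T.powersetCard) :=
        card_le_card fun R hR => by
          obtain ⟨hRT, hRk⟩ := mem_filter.1 hR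
          exact mem_biUnion.2 ⟨#R, mem_range.2 (Nat.lt_succ_of_le hRk),
            mem_powersetCard.2 ⟨mem_powerset.1 hRT, rfl⟩⟩
    _ ≤ ∑ i ∈ range (k + 1), (#T).choose i := by
        simpa only [card_powersetCard] using
          card_biUnion_le (s := range (k + 1)) (t := T.powersetCard)
    _ ≤ ∑ i ∈ range (k + 1), #T ^ i * 1 ^ (k - i) * k.choose i := sum_le_sum fun i hi => by
        rw [one_pow, mul_one]
        exact (Nat.choose_le_pow _ _).trans <| Nat.le_mul_of_pos_right _ <|
          Nat.choose_pos (Nat.le_of_lt_succ (mem_range.1 hi))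
    _ = (#T + 1) ^ k := (add_pow _ _ _).symm

lemma exists_ne_mem_orbit_of_lt_card {ι X : Type*} [MulAction G X] {n : ℕ} (hn : numOrbits X ≤ n)
    {S : Finset ι} (hS : n < #S) (x : ι → X) :
    ∃ i ∈ S, ∃ j ∈ S, i ≠ j ∧ x i ∈ orbit G (x j) := by
  have : Finite (orbitRel.Quotient G X) :=
    ENat.card_lt_top.1 (hn.trans_lt (ENat.natCast_lt_top n))
  have := Fintype.ofFinite (orbitRel.Quotient G X)
  rw [numOrbits, ENat.card_eq_coe_fintype_card, Nat.cast_le] at hn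
  obtain ⟨i, hi, j, hj, hij, h⟩ := exists_ne_map_eq_of_card_lt_of_maps_to (hn.trans_lt hS)
    (f := fun i => (Quotient.mk _ (x i) : orbitRel.Quotient G X)) fun _ _ => mem_univ _
  exact ⟨i, hi, j, hj, hij, orbitRel_apply.1 (Quotient.exact h)⟩

/-- The witness is the graph of the restriction of `π` to the least support of `x`. -/
lemma IsLeastSupport.exists_subset_product {X : Type*} [MulAction G X] {x : X} {D T : Finset ℕ}
    {π : G} (hD : IsLeastSupport D x) (hx : Supports G (T : Set ℕ) x)
    (hπx : Supports G (T : Set ℕ) (π • x)) :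
    ∃ R ⊆ T ×ˢ T, #R ≤ #D ∧ (∀ y ∈ R, π y.1 = y.2) ∧
      ∀ ρ : G, (∀ y ∈ R, ρ y.1 = y.2) → ρ • x = π • x := by
  refine ⟨D.image fun a => (a, π a), image_subset_iff.2 fun a ha => ?_, card_image_le,
    by simp, fun ρ hρ => ?_⟩
  · exact mem_product.2 ⟨hD.1.subset hx ha, hD.smul_subset hπx (smul_mem_smul_finset ha)⟩
  · exact smul_eq_smul_of_supports hD.supports fun a ha => hρ (a, π a) (mem_image_of_mem _ ha)

lemma IsConsistent.exists_forall_append_eq {A : Type u} {𝓒 : Set (List A → Bool)} {m : ℕ}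
    {f : List A → Bool} (h : IsConsistent 𝓒 m f) {P : Finset (List A × List A)}
    (hP : 2 * #P ≤ m) :
    ∃ C ∈ 𝓒, ∀ x ∈ P, (∀ e, C (x.1 ++ e) = C (x.2 ++ e)) → ∀ e, f (x.1 ++ e) = f (x.2 ++ e) := by
  classical
  let e (x : List A × List A) : List A := Classical.epsilon fun e => f (x.1 ++ e) ≠ f (x.2 ++ e)
  obtain ⟨C, hC, hCf⟩ := h (P.image (fun x => x.1 ++ e x) ∪ P.image fun x => x.2 ++ e x) <| by
    refine (card_union_le _ _).trans (le_trans ?_ hP)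
    rw [two_mul]
    exact add_le_add card_image_le card_image_le
  refine ⟨C, hC, fun x hx hCx => ?_⟩
  by_contra! hne
  apply Classical.epsilon_spec hne
  rw [← hCf _ (mem_union_left _ (mem_image_of_mem _ hx)),
    ← hCf _ (mem_union_right _ (mem_image_of_mem _ hx)), hCx]

section Consistency

variable {A : Type u} [MulAction G A] {f : List A → Bool} {n k m p : ℕ}

lemma isGLanguage_of_isConsistent (hm : 2 ≤ m) (h : IsConsistent (nominalLanguages A n k) m f) :
    IsGLanguage f := fun w hw π => by
  classical
  obtain ⟨C, hC, hCf⟩ := h {w, w.map (π • ·)} (card_le_two.trans hm)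
  have hCw : C w = true := (hCf w (by simp)).trans hw
  exact (hCf _ (by simp)).symm.trans (hC.1 w hCw π)

variable {hf : IsGLanguage f}

lemma exists_supports_residual_of_isConsistent (h : IsConsistent (nominalLanguages A n k) m f)
    {w : List A} {T : Finset ℕ} (hT : Supports G (T : Set ℕ) w) (hm : 2 * (#T + 1) ^ k ≤ m) :
    ∃ R : Finset ℕ, #R ≤ k ∧ Supports G (R : Set ℕ) (residual hf w) := by
  classical
  by_contra! hns
  simp only [Supports, not_forall] at hns
  choose! π hπ hne using hns
  obtain ⟨C, ⟨-, M, -, hMk, hM⟩, hC⟩ := h.exists_forall_append_eq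
    (P := {R ∈ T.powerset | #R ≤ k}.image fun R => (w, π R • w))
    (le_trans (Nat.mul_le_mul_left 2 (card_image_le.trans (card_filter_powerset_card_le T k))) hm)
  obtain ⟨D, hD⟩ := M.nominal (M.toDFA.eval w)
  have hDT : D ⊆ T := hD.1.subset (NominalDFA.supports_eval hT)
  have hDk : #D ≤ k := nominalDim_le_iff.1 hMk _ D hD
  have heval : M.toDFA.eval w = M.toDFA.eval (π D • w) := by
    rw [← NominalDFA.smul_eval]
    exact (hD.supports (π D) (hπ D hDk)).symm
  apply hne D hDk
  rw [smul_residual]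
  refine (residual_eq_residual_iff.2 (hC (w, π D • w) ?_ (hM.append_eq heval))).symm
  exact mem_image_of_mem _ (mem_filter.2 ⟨mem_powerset.2 hDT, hDk⟩)

lemma not_injOn_residualOrbit_of_isConsistent (h : IsConsistent (nominalLanguages A n k) m f)
    {S : Finset (List A)} {T : Finset ℕ} (hS : n < #S)
    (hT : ∀ w ∈ S, Supports G (T : Set ℕ) w) (hm : 2 * (#S ^ 2 * (#T ^ 2 + 1) ^ k) ≤ m) :
    ¬ Set.InjOn (residualOrbit hf) S := fun hinj => by
  classical
  let ext (R : Finset (ℕ × ℕ)) : G := Classical.epsilon fun π => ∀ y ∈ R, π y.1 = y.2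
  obtain ⟨C, ⟨-, M, hMn, hMk, hM⟩, hC⟩ := h.exists_forall_append_eq
    (P := ((S ×ˢ S) ×ˢ {R ∈ (T ×ˢ T).powerset | #R ≤ k}).image
      fun x => (x.1.1, ext x.2 • x.1.2)) <| by
    refine le_trans (Nat.mul_le_mul_left 2 (card_image_le.trans ?_)) hm
    rw [card_product, card_product, ← sq, sq #T, ← card_product]
    exact Nat.mul_le_mul_left _ (card_filter_powerset_card_le _ k)
  obtain ⟨v, hv, w, hw, hvw, horbit⟩ := exists_ne_mem_orbit_of_lt_card hMn hS M.toDFA.eval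
  obtain ⟨π, hπ⟩ := mem_orbit_iff.1 horbit
  obtain ⟨D, hD⟩ := M.nominal (M.toDFA.eval w)
  obtain ⟨R, hRT, hRD, hRπ, hR⟩ := hD.exists_subset_product (π := π)
    (NominalDFA.supports_eval (hT w hw)) (hπ ▸ NominalDFA.supports_eval (hT v hv))
  have hRk : #R ≤ k := hRD.trans (nominalDim_le_iff.1 hMk _ D hD)
  have hext : ∀ y ∈ R, ext R y.1 = y.2 :=
    Classical.epsilon_spec (p := fun ρ : G => ∀ y ∈ R, ρ y.1 = y.2) ⟨π, hRπ⟩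
  have heval : M.toDFA.eval v = M.toDFA.eval (ext R • w) := by
    rw [← NominalDFA.smul_eval, hR _ hext, hπ]
  refine hvw (hinj hv hw (residualOrbit_eq_residualOrbit_iff.2 ⟨ext R, ?_⟩))
  refine (residual_eq_residual_iff.2 (hC (v, ext R • w) ?_ (hM.append_eq heval))).symm
  exact mem_image.2 ⟨((v, w), R), mem_product.2 ⟨mem_product.2 ⟨hv, hw⟩,
    mem_filter.2 ⟨mem_powerset.2 hRT, hRk⟩⟩, rfl⟩

variable (hp : ∀ a : A, ∃ D : Finset ℕ, #D ≤ p ∧ Supports G (D : Set ℕ) a)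
include hp

lemma numOrbits_residuals_le_of_isConsistent (h : IsConsistent (nominalLanguages A n k) m f)
    (hm : 2 * ((n + 1) ^ 2 * (((n + 1) * (n * p)) ^ 2 + 1) ^ k) ≤ m) :
    numOrbits (residuals hf) ≤ n := by
  classical
  by_contra! hn
  obtain ⟨S, hS, hSn, hinj⟩ := exists_short_words_of_lt_numOrbits hn
  choose D hDp hD using exists_supports_word hp
  have hT : #(S.biUnion D) ≤ (n + 1) * (n * p) :=
    hS ▸ card_biUnion_le_card_mul S D (n * p) fun w hw =>
      (hDp w).trans (Nat.mul_le_mul_right p (hSn w hw))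
  refine not_injOn_residualOrbit_of_isConsistent h (T := S.biUnion D) (hS ▸ n.lt_succ_self)
    (fun w hw => (hD w).mono (coe_subset.2 (subset_biUnion_of_mem D hw))) (le_trans ?_ hm) hinj
  rw [hS]
  gcongr

lemma nominalDim_residuals_le_of_isConsistent (h : IsConsistent (nominalLanguages A n k) m f)
    (hn : numOrbits (residuals hf) ≤ n) (hm : 2 * (n * p + 1) ^ k ≤ m) :
    nominalDim (residuals hf) ≤ k := by
  refine nominalDim_le_iff.2 fun x F hF => ?_
  obtain ⟨w, hw, π, rfl⟩ := exists_short_word_of_numOrbits_le hn x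
  obtain ⟨T, hTp, hT⟩ := exists_supports_word hp w
  have hTn : #T ≤ n * p := hTp.trans (Nat.mul_le_mul_right p hw)
  obtain ⟨R, hRk, hR⟩ := exists_supports_residual_of_isConsistent (hf := hf) h hT
    (hm.trans' (by gcongr))
  have hFR : F ⊆ π • R := hF.1.subset <| by
    rw [coe_smul_finset, ← smul_residual]
    exact supports_smul π hR
  exact (card_le_card hFR).trans ((card_smul_finset π R).trans_le hRk)

theorem mem_nominalLanguages_of_isConsistent
    (h : IsConsistent (nominalLanguages A n k)
      (2 * ((n + 1) ^ 2 * (((n + 1) * (n * p)) ^ 2 + 1) ^ k)) f) :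
    f ∈ nominalLanguages A n k := by
  have hf : IsGLanguage f := isGLanguage_of_isConsistent
    (Nat.le_mul_of_pos_right 2 (by positivity)) h
  have hn : numOrbits (residuals hf) ≤ n := numOrbits_residuals_le_of_isConsistent hp h le_rfl
  have hbound : n * p ≤ ((n + 1) * (n * p)) ^ 2 :=
    (Nat.le_mul_of_pos_left _ n.succ_pos).trans (Nat.le_self_pow two_ne_zero _)
  refine mem_nominalLanguages_of_residuals
    (fun w => (exists_supports_word hp w).imp fun _ hD => hD.2) hn
    (nominalDim_residuals_le_of_isConsistent hp h hn ?_)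
  calc 2 * (n * p + 1) ^ k ≤ 2 * (((n + 1) * (n * p)) ^ 2 + 1) ^ k := by gcongr
    _ ≤ _ := Nat.mul_le_mul_left 2 (Nat.le_mul_of_pos_left _ (by positivity))

end Consistency

/-! ### Counting automata -/

lemma accepts_eq_of_bisimulation {α σ σ' : Type*} {M : DFA α σ} {M' : DFA α σ'}
    (R : σ → σ' → Prop) (hstart : R M.start M'.start)
    (hstep : ∀ {x x'} a, R x x' → R (M.step x a) (M'.step x' a))
    (haccept : ∀ {x x'}, R x x' → (x ∈ M.accept ↔ x' ∈ M'.accept)) : M.accepts = M'.accepts := by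
  have heval (w : List α) : R (M.eval w) (M'.eval w) := by
    induction w using List.reverseRecOn with
    | nil => exact hstart
    | append_singleton w a ih => simpa only [DFA.eval_append_singleton] using hstep a ih
  ext w
  exact haccept (heval w)

section Representatives

variable {O X : Type*} [MulAction G X] {k m p : ℕ} {r : O → X}

lemma IsRepresentatives.smul_eq_smul (hr : IsRepresentatives p r) {ρ ρ' : G}
    (h : ∀ l : Fin p, ρ l = ρ' l) (o : O) : ρ • r o = ρ' • r o :=
  smul_eq_smul_of_supports (hr.supports o) fun l hl => h ⟨l, by simpa using hl⟩

lemma IsRepresentatives.exists_smul_smul_eq (hr : IsRepresentatives p r) (k : ℕ) (x : X) :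
    ∃ (o : O) (σ ρ : G), (∀ l < k, σ l = l) ∧ (∀ l < p, ρ l < k + p) ∧ σ • ρ • r o = x := by
  obtain ⟨o, π, rfl⟩ := hr.exists_smul_eq x
  obtain ⟨σ, hσ, hσE⟩ := exists_perm_fixing_mapsTo (K := range k) (Y := Ico k (k + p))
    (E := π • range p) (by simp +contextual [Finset.disjoint_left])
    ((card_le_card sdiff_subset).trans (by simp))
  refine ⟨o, σ⁻¹, σ * π, fun l hl => ?_, fun l hl => ?_, by simp [mul_smul]⟩
  · rw [Equiv.Perm.inv_eq_iff_eq, hσ l (mem_range.2 hl)]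
  · rw [Equiv.Perm.mul_apply]
    by_cases h : π l ∈ range k
    · rw [hσ _ h]
      exact (mem_range.1 h).trans_le (Nat.le_add_right k p)
    · exact (mem_Ico.1 (hσE _ (smul_mem_smul_finset (mem_range.2 hl)) h)).2

lemma exists_smul_eq_of_supports_range (hkm : k ≤ m) {x : X} {π : G}
    (hx : Supports G (range k : Set ℕ) x) (hπx : Supports G (range m : Set ℕ) (π • x)) :
    ∃ τ : G, (∀ l < k, τ l < m) ∧ τ • x = π • x := by
  obtain ⟨D, hD⟩ := exists_isLeastSupport hx
  have hDk : D ⊆ range k := by simpa using hD.smul_subset (π := 1) (by simpa using hx)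
  have hDm : π • D ⊆ range m := hD.smul_subset hπx
  obtain ⟨σ, hσ, hσE⟩ := exists_perm_fixing_mapsTo (K := π • D) (Y := range m \ π • D)
    (E := π • range k) sdiff_disjoint (by
      rw [card_sdiff_of_subset (smul_finset_subset_smul_finset hDk), card_sdiff_of_subset hDm,
        card_smul_finset, card_smul_finset, card_range, card_range]
      exact Nat.sub_le_sub_right hkm _)
  refine ⟨σ * π, fun l hl => ?_, ?_⟩
  · rw [Equiv.Perm.mul_apply]
    by_cases h : π l ∈ π • D
    · rw [hσ _ h]
      exact mem_range.1 (hDm h)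
    · have hl' : π l ∈ π • range k := smul_mem_smul_finset (mem_range.2 hl)
      exact mem_range.1 (mem_sdiff.1 (hσE _ hl' h)).1
  · refine smul_eq_smul_of_supports hD.supports fun a ha => ?_
    exact hσ _ (smul_mem_smul_finset (mem_coe.1 ha))

end Representatives

section Codes

variable {A : Type u} [MulAction G A] {O : Type*} {n k p : ℕ}

/-- Finite descriptions of nominal automata over an alphabet with orbit representatives indexed by
`O`: the accepting representatives among `n` state representatives, the initial ones, and the
transitions between representatives. A permutation is recorded by its values on an initial segment
of `ℕ`. -/
abbrev AutomatonCode (O : Type*) (n k p : ℕ) : Type _ :=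
  Set (Fin n) × Set (Fin n) ×
    Set (Fin n × O × (Fin p → Fin (k + p)) × Fin n × (Fin k → Fin (k + p)))

namespace NominalDFA

/-- The description of `M` relative to state representatives `q` and letter representatives `r`:
`(i, o, t, j, u)` is listed if `q i` goes to `τ • q j` on reading `ρ • r o`, for some permutations
`ρ` and `τ` that extend `t` and `u`. -/
def code (M : NominalDFA A) (q : Fin n → M.Q) (r : O → A) : AutomatonCode O n k p :=
  ({i | q i ∈ M.toDFA.accept}, {i | q i = M.toDFA.start},
    {(i, o, t, j, u) | ∃ ρ τ : G, (∀ l : Fin p, ρ l = t l) ∧ (∀ l : Fin k, τ l = u l) ∧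
      M.toDFA.step (q i) (ρ • r o) = τ • q j})

variable {M M' : NominalDFA A} {q : Fin n → M.Q} {q' : Fin n → M'.Q} {r : O → A}

lemma exists_eq_start (hq : IsRepresentatives k q) : ∃ i, q i = M.toDFA.start := by
  obtain ⟨i, π, hi⟩ := hq.exists_smul_eq M.toDFA.start
  exact ⟨i, by rw [← inv_smul_smul π (q i), hi, smul_start]⟩

lemma exists_smul_eq_step (hq : IsRepresentatives k q) (hr : IsRepresentatives p r) (i : Fin n)
    (o : O) {ρ : G} (hρ : ∀ l < p, ρ l < k + p) :
    ∃ (j : Fin n) (τ : G), (∀ l < k, τ l < k + p) ∧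
      τ • q j = M.toDFA.step (q i) (ρ • r o) := by
  obtain ⟨j, π, hj⟩ := hq.exists_smul_eq (M.toDFA.step (q i) (ρ • r o))
  have hsupp : Supports G (range (k + p) : Set ℕ) (M.toDFA.step (q i) (ρ • r o)) := by
    refine (supports_step (hq.supports i) (supports_smul ρ (hr.supports o))).mono ?_
    rintro _ (hl | ⟨l, hl, rfl⟩)
    · exact mem_coe.2 (range_mono (Nat.le_add_right k p) (mem_coe.1 hl))
    · exact mem_coe.2 (mem_range.2 (hρ l (mem_range.1 (mem_coe.1 hl))))
  obtain ⟨τ, hτ, hτj⟩ := exists_smul_eq_of_supports_range (Nat.le_add_right k p) (hq.supports j)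
    (hj ▸ hsupp)
  exact ⟨j, τ, hτ, hτj.trans hj⟩

lemma mk_mem_code_iff (hq : IsRepresentatives k q) (hr : IsRepresentatives p r) {i j : Fin n}
    {o : O} {t : Fin p → Fin (k + p)} {u : Fin k → Fin (k + p)} {ρ τ : G}
    (hρ : ∀ l : Fin p, ρ l = t l) (hτ : ∀ l : Fin k, τ l = u l) :
    (i, o, t, j, u) ∈ (M.code (k := k) q r).2.2 ↔ M.toDFA.step (q i) (ρ • r o) = τ • q j := by
  refine ⟨?_, fun h => ⟨ρ, τ, hρ, hτ, h⟩⟩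
  rintro ⟨ρ', τ', hρ', hτ', h⟩
  rwa [hr.smul_eq_smul (fun l => (hρ' l).trans (hρ l).symm),
    hq.smul_eq_smul (fun l => (hτ' l).trans (hτ l).symm)] at h

lemma accepts_eq_of_code_eq (hq : IsRepresentatives k q) (hq' : IsRepresentatives k q')
    (hr : IsRepresentatives p r)
    (h : (M.code q r : AutomatonCode O n k p) = M'.code q' r) :
    M.toDFA.accepts = M'.toDFA.accepts := by
  have haccept (i : Fin n) : q i ∈ M.toDFA.accept ↔ q' i ∈ M'.toDFA.accept :=
    Set.ext_iff.1 (congrArg Prod.fst h) i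
  have hstart (i : Fin n) : q i = M.toDFA.start ↔ q' i = M'.toDFA.start :=
    Set.ext_iff.1 (congrArg (·.2.1) h) i
  refine accepts_eq_of_bisimulation (fun x x' => ∃ (i : Fin n) (π : G), π • q i = x ∧ π • q' i = x')
    ?_ ?_ ?_
  · obtain ⟨i, hi⟩ := exists_eq_start hq
    exact ⟨i, 1, by rw [one_smul, hi], by rw [one_smul, (hstart i).1 hi]⟩
  · rintro _ _ a ⟨i, π, rfl, rfl⟩
    obtain ⟨o, σ, ρ, hσ, hρ, ha⟩ := hr.exists_smul_smul_eq k (π⁻¹ • a)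
    obtain ⟨j, τ, hτ, hstep⟩ := exists_smul_eq_step hq hr i o hρ
    let t (l : Fin p) : Fin (k + p) := ⟨ρ l, hρ l l.2⟩
    let u (l : Fin k) : Fin (k + p) := ⟨τ l, hτ l l.2⟩
    have hmem : (i, o, t, j, u) ∈ (M.code q r : AutomatonCode O n k p).2.2 :=
      (mk_mem_code_iff hq hr (fun _ => rfl) fun _ => rfl).2 hstep.symm
    have hstep' : M'.toDFA.step (q' i) (ρ • r o) = τ • q' j :=
      (mk_mem_code_iff hq' hr (fun _ => rfl) fun _ => rfl).1 (h ▸ hmem)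
    obtain rfl : (π * σ) • ρ • r o = a := by rw [mul_smul, ha, smul_inv_smul]
    have hmove {N : NominalDFA A} {s : Fin n → N.Q} (hs : IsRepresentatives k s) :
        N.toDFA.step (π • s i) ((π * σ) • ρ • r o) = (π * σ) • N.toDFA.step (s i) (ρ • r o) := by
      rw [← N.step_equivariant, mul_smul π σ (s i),
        hs.supports i σ fun l hl => hσ l (mem_range.1 (mem_coe.1 hl))]
    exact ⟨j, π * σ * τ, by rw [hmove hq, ← hstep, mul_smul],
      by rw [hmove hq', hstep', mul_smul]⟩
  · rintro _ _ ⟨i, π, rfl, rfl⟩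
    rw [smul_mem_accept_iff, smul_mem_accept_iff, haccept]

end NominalDFA

lemma exists_injective_automatonCode {r : O → A} (hr : IsRepresentatives p r) (n k : ℕ) :
    ∃ code : nominalLanguages A n k → AutomatonCode O n k p, code.Injective := by
  have hrep (L : nominalLanguages A n k) : ∃ (M : NominalDFA A) (q : Fin n → M.Q),
      M.Recognizes L.1 ∧ IsRepresentatives k q := by
    obtain ⟨L, -, M, hn, hk, hM⟩ := L
    have : Nonempty M.Q := ⟨M.toDFA.start⟩
    obtain ⟨q, hq⟩ := exists_isRepresentatives_fin M.nominal hn hk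
    exact ⟨M, q, hM, hq⟩
  choose M q hM hq using hrep
  refine ⟨fun L => (M L).code (q L) r, fun L L' h => Subtype.ext (funext fun w => ?_)⟩
  rw [Bool.eq_iff_iff, ← hM L, ← hM L', NominalDFA.accepts_eq_of_code_eq (hq L) (hq L') hr h]

variable [Finite O] {r : O → A}

lemma finite_nominalLanguages (hr : IsRepresentatives p r) (n k : ℕ) :
    (nominalLanguages A n k).Finite := by
  obtain ⟨code, hcode⟩ := exists_injective_automatonCode hr n k
  exact Finite.of_injective code hcode

lemma ncard_nominalLanguages_le (hr : IsRepresentatives p r) (n k : ℕ) :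
    (nominalLanguages A n k).ncard ≤
      2 ^ (n + (n + n * (Nat.card O * ((k + p) ^ p * (n * (k + p) ^ k))))) := by
  have := Fintype.ofFinite O
  obtain ⟨code, hcode⟩ := exists_injective_automatonCode hr n k
  calc (nominalLanguages A n k).ncard
      ≤ Nat.card (AutomatonCode O n k p) := Nat.card_le_card_of_injective code hcode
    _ = _ := by
      simp only [Nat.card_eq_fintype_card, Fintype.card_prod, Fintype.card_set, Fintype.card_fin,
        Fintype.card_pi, prod_const, card_univ, pow_add]

end Codes

/-! ### The size of the bound -/

lemma exists_forall_eval_le_pow (P : Polynomial ℕ) : ∃ K : ℕ, ∀ n ≥ 2, P.eval n ≤ n ^ K := by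
  induction P using Polynomial.induction_on' with
  | add P Q hP hQ =>
    obtain ⟨K, hK⟩ := hP
    obtain ⟨K', hK'⟩ := hQ
    refine ⟨max K K' + 1, fun n hn => ?_⟩
    have hn0 : 0 < n := by omega
    calc (P + Q).eval n ≤ n ^ max K K' + n ^ max K K' := by
          rw [Polynomial.eval_add]
          exact add_le_add ((hK n hn).trans (Nat.pow_le_pow_right hn0 (le_max_left K K')))
            ((hK' n hn).trans (Nat.pow_le_pow_right hn0 (le_max_right K K')))
      _ = n ^ max K K' * 2 := (mul_two _).symm
      _ ≤ n ^ (max K K' + 1) := Nat.mul_le_mul_left _ hn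
  | monomial m a =>
    refine ⟨a + m, fun n hn => ?_⟩
    rw [Polynomial.eval_monomial, pow_add]
    gcongr
    exact Nat.lt_two_pow_self.le.trans (Nat.pow_le_pow_left hn a)

/-- Each factor on the left is at most the `k`-th power of a polynomial in `n` and `k ≤ n ^ c`. -/
lemma exists_forall_queries_le_pow (p o c : ℕ) : ∃ K : ℕ, ∀ n k : ℕ, 2 ≤ n → 1 ≤ k → k ≤ n ^ c →
    2 * ((n + 1) ^ 2 * (((n + 1) * (n * p)) ^ 2 + 1) ^ k) *
      (n + (n + n * (o * ((k + p) ^ p * (n * (k + p) ^ k)))) + 1) * k ^ k ≤ n ^ (K * k) := by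
  open Polynomial in
  let P : ℕ[X] := 2 * ((X + 1) ^ 2 * (((X + 1) * (X * (p : ℕ[X]))) ^ 2 + 1)) *
    ((X + (X + X * ((o : ℕ[X]) * ((X ^ c + (p : ℕ[X])) ^ p * X))) + 1) * (X ^ c + (p : ℕ[X]))) *
      X ^ c
  obtain ⟨K, hK⟩ := exists_forall_eval_le_pow P
  refine ⟨K, fun n k hn hk hkc => ?_⟩
  have hk0 : k ≠ 0 := by omega
  have htests : 2 * ((n + 1) ^ 2 * (((n + 1) * (n * p)) ^ 2 + 1) ^ k) ≤
      (2 * ((n + 1) ^ 2 * (((n + 1) * (n * p)) ^ 2 + 1))) ^ k := by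
    rw [mul_pow 2, mul_pow ((n + 1) ^ 2)]
    exact Nat.mul_le_mul (Nat.le_self_pow hk0 2)
      (Nat.mul_le_mul_right _ (Nat.le_self_pow hk0 _))
  have hcodes : n + (n + n * (o * ((k + p) ^ p * (n * (k + p) ^ k)))) + 1 ≤
      ((n + (n + n * (o * ((k + p) ^ p * n))) + 1) * (k + p)) ^ k := by
    have hone : 1 ≤ (k + p) ^ k := Nat.one_le_pow _ _ (by omega)
    calc n + (n + n * (o * ((k + p) ^ p * (n * (k + p) ^ k)))) + 1
        ≤ (n + (n + n * (o * ((k + p) ^ p * n))) + 1) * (k + p) ^ k := by nlinarith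
      _ ≤ (n + (n + n * (o * ((k + p) ^ p * n))) + 1) ^ k * (k + p) ^ k := by
          gcongr
          exact Nat.le_self_pow hk0 _
      _ = _ := (mul_pow _ _ k).symm
  calc _ ≤ (2 * ((n + 1) ^ 2 * (((n + 1) * (n * p)) ^ 2 + 1))) ^ k *
        ((n + (n + n * (o * ((k + p) ^ p * n))) + 1) * (k + p)) ^ k * k ^ k := by gcongr
    _ ≤ (P.eval n) ^ k := by
      simp only [P, Polynomial.eval_mul, Polynomial.eval_add, Polynomial.eval_pow,
        Polynomial.eval_X, Polynomial.eval_natCast, Polynomial.eval_one, Polynomial.eval_ofNat,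
        ← mul_pow, Nat.cast_id]
      gcongr
    _ ≤ n ^ (K * k) := by
      rw [pow_mul]
      exact Nat.pow_le_pow_left (hK n hn) k

end NominalLearning

theorem mainTheorem2 {A : Type*} [MulAction NominalLearning.G A]
    (hA : NominalLearning.IsNominal A) (hfin : NominalLearning.OrbitFinite A) (c : ℕ) :
    ∃ C : ℕ, ∀ n k : ℕ, 2 ≤ n → 1 ≤ k → k ≤ n ^ c →
      (NominalLearning.queryComplexity (NominalLearning.nominalLanguages A n k)
          (NominalLearning.nominalLanguages A n k) : ENNReal) ≤
        (n : ENNReal) ^ (C * k) / (k : ENNReal) ^ k := by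
  have : Finite (MulAction.orbitRel.Quotient NominalLearning.G A) := hfin
  obtain ⟨p, r, hr⟩ := NominalLearning.exists_isRepresentatives hA hfin
  obtain ⟨K, hK⟩ := NominalLearning.exists_forall_queries_le_pow p
    (Nat.card (MulAction.orbitRel.Quotient NominalLearning.G A)) c
  refine ⟨K, fun n k hn hk hkc => ?_⟩
  have hquery := NominalLearning.queryComplexity_le_mul_of_isConsistent
    (NominalLearning.finite_nominalLanguages hr n k) (Nat.succ_le_of_lt (by positivity))
    ((NominalLearning.ncard_nominalLanguages_le hr n k).trans_lt
      (Nat.pow_lt_pow_right one_lt_two (Nat.lt_succ_self _)))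
    fun _ => NominalLearning.mem_nominalLanguages_of_isConsistent hr.exists_supports_card_le
  have hk0 : (k : ENNReal) ^ k ≠ 0 := pow_ne_zero _ (Nat.cast_ne_zero.2 (by omega))
  rw [ENNReal.le_div_iff_mul_le (.inl hk0) (.inl (ENNReal.pow_ne_top (ENNReal.natCast_ne_top k)))]
  calc _ ≤ (_ : ENNReal) * (k : ENNReal) ^ k := mul_le_mul_left (ENat.toENNReal_le.2 hquery) _
    _ ≤ (n : ENNReal) ^ (K * k) := by
      rw [ENat.toENNReal_coe]
      exact_mod_cast hK n k hn hk hkc
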